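/- Let $(W,S)$ be a Coxeter system with $S$ finite, Coxeter matrix $(m_{st})$ and length function $\ell$. An element $w\in W$ is *fully commutative* if any reduced expression of $w$ can be obtained from any other one by exchanging adjacent letters $s,t$ with $m_{st}=2$; it is *cyclically fully commutative* (CFC) if every cyclic shift of every reduced expression of $w$ is a reduced expression of a fully commutative element. A *CFC involution* is a CFC element $w$ with $w^2=1$ (so $w=1$ is allowed). Put $$W(q)=\sum_{w\text{ CFC involution of }W} q^{\ell(w)} .$$ Write $A_n$ ($n\ge 0$), $B_n$ ($n\ge2$), $D_n$ ($n\ge2$), $\tilde A_n$ ($n\ge1$), $\tilde B_n$ ($n\ge2$), $\tilde C_n$ ($n\ge1$), $\tilde D_n$ ($n\ge4$) for this sum when $W$ is the Coxeter group of that type. The finite types have $n$ generators and the affine types have $n+1$. The low-rank diagrams are: $D_2=A_1\times A_1$, $D_3=A_3$, $\tilde B_2=\tilde C_2$ (a path on three vertices with both edges labelled $4$), and $\tilde A_1=\tilde C_1$ is the infinite dihedral group. By convention put $D_1:=1$ and $\tilde A_0:=1$ (as polynomials). Then for all these groups the set of CFC involutions is finite, so all these sums are polynomials in $q$, and the following hold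 (the generating functions being formal power series in $x$ over $\mathbb Z[q]$). 1. (Types $A$, $B$, $\tilde C$.) For all $n\ge 2$, $$A_n=B_n=\tilde C_{n-1}=A_{n-1}+q\,A_{n-2},$$ with $A_0=1$, $A_1=1+q$, and $$\sum_{n\ge1}A_{n-1}x^n=\frac{x(1+qx)}{1-x-qx^2}.$$ 2. (Types $D$, $\tilde B$.) For all $n\ge3$, $$D_n=\tilde B_{n-1}=D_{n-1}+q\,D_{n-2},\qquad D_{n+1}=q\,A_{n-3}+(1+2q+q^2)\,A_{n-2},$$ with $D_1=1$, $D_2=1+2q+q^2$, $D_3=1+3q+q^2$, and $$\sum_{n\ge0}D_{n+1}x^n=\frac{1+(2q+q^2)x}{1-x-qx^2}.$$ 3. (Type $\tilde A$.) For all $n\ge2$, $$\tilde A_n=\tilde A_{n-1}+q\,\tilde A_{n-2},$$ with $\tilde A_0=1$, $\tilde A_1=1+2q$, and $$\sum_{n\ge1}\tilde A_{n-1}x^n=\frac{x(1+2qx)}{1-x-qx^2}.$$ 4. (Type $\tilde D$.) For all $n\ge4$, $$\tilde D_{n+2}=\tilde D_{n+1}+q\,\tilde D_n,$$ with $\tilde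 D_4=1+5q+6q^2+4q^3+q^4$, $\tilde D_5=1+6q+10q^2+6q^3+q^4$, and $$\sum_{n\ge2}\tilde D_{n+2}x^n=\frac{x^2\left(1+5q+6q^2+4q^3+q^4+x(q+4q^2+2q^3)\right)}{1-x-qx^2}.$$ -/

import Mathlib

noncomputable section

namespace CFCI

/-! ### Fully commutative and cyclically fully commutative elements -/

section CoxeterSystem

variable {B W : Type*} [Group W] {M : CoxeterMatrix B} (cs : CoxeterSystem M W)

/-- One commutation relation: exchange two adjacent letters `s`, `t` with `m_{st} = 2`. -/
inductive CommStep (M : CoxeterMatrix B) : List B → List B → Prop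
  | swap (u v : List B) (s t : B) (h : M s t = 2) :
      CommStep M (u ++ s :: t :: v) (u ++ t :: s :: v)

/-- Two words are commutation equivalent if a finite sequence of commutation relations
transforms one into the other. -/
def CommEquiv (M : CoxeterMatrix B) : List B → List B → Prop :=
  Relation.ReflTransGen (CommStep M)

/-- `w` is fully commutative: any reduced expression of `w` can be obtained from any other one
using only commutation relations. -/
def IsFC (w : W) : Prop :=
  ∀ ω ω' : List B, cs.IsReduced ω → cs.wordProd ω = w → cs.IsReduced ω' → cs.wordProd ω' = w →
    CommEquiv M ω ω'

/-- `w` is cyclically fully commutative: every cyclic shift of any reduced expression of `w` is a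
reduced expression of a fully commutative element. -/
def IsCFC (w : W) : Prop :=
  ∀ ω : List B, cs.IsReduced ω → cs.wordProd ω = w →
    ∀ k : ℕ, cs.IsReduced (ω.rotate k) ∧ IsFC cs (cs.wordProd (ω.rotate k))

/-- The set of cyclically fully commutative involutions. The identity counts as an involution. -/
def cfcInvolutions : Set W := {w | IsCFC cs w ∧ w * w = 1}

/-- The length polynomial `∑ q ^ ℓ(w)` over the cyclically fully commutative involutions `w`,
where the variable `q` is `Polynomial.X`. -/
def lengthPoly : Polynomial ℤ :=
  ∑ᶠ w ∈ cfcInvolutions cs, (Polynomial.X : Polynomial ℤ) ^ cs.length w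

end CoxeterSystem

/-! ### Coxeter matrices

Types `A` and `B` are `CoxeterMatrix.A` and `CoxeterMatrix.B`. As in Mathlib, the entry `0` stands
for the label `∞`. -/

/-- Type `C̃_n` (`n ≥ 1`): the path `0 — 1 — ⋯ — n`, the first and last edges being labelled `4`,
and the other ones `3`. For `n = 1`, this is the infinite dihedral group. -/
def matCt (n : ℕ) : CoxeterMatrix (Fin (n + 1)) where
  M := Matrix.of fun i j =>
    if i = j then 1
    else if (i : ℕ) + 1 = j ∨ (j : ℕ) + 1 = i then
      if n = 1 then 0
      else if (i : ℕ) = 0 ∨ (j : ℕ) = 0 ∨ (i : ℕ) = n ∨ (j : ℕ) = n then 4 else 3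
    else 2
  isSymm := by
    ext i j
    simp only [Matrix.transpose_apply, Matrix.of_apply]
    grind
  diagonal := by simp
  off_diagonal := by
    intro i j h
    simp only [Matrix.of_apply]
    grind

/-- The edges `i — j`, `i < j`, of the half-infinite diagram with a fork at its beginning:
`0 — 2`, `1 — 2`, `2 — 3`, `3 — 4`, … . -/
def ForkEdge (i j : ℕ) : Prop := (i = 0 ∧ j = 2) ∨ (1 ≤ i ∧ i + 1 = j)

instance : DecidableRel ForkEdge := fun i j => by unfold ForkEdge; infer_instance

/-- Type `D_n` (`n ≥ 2`), with generators `t₁ = 0`, `t₂ = 1` and `s_i = i + 1` (`1 ≤ i ≤ n - 2`).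
So `D_2 = A_1 × A_1` and `D_3 = A_3`. -/
def matD (n : ℕ) : CoxeterMatrix (Fin n) where
  M := Matrix.of fun i j =>
    if i = j then 1
    else if ForkEdge i j ∨ ForkEdge j i then 3
    else 2
  isSymm := by
    ext i j
    simp only [Matrix.transpose_apply, Matrix.of_apply]
    grind
  diagonal := by simp
  off_diagonal := by
    intro i j h
    simp only [Matrix.of_apply]
    grind

/-- Type `B̃_n` (`n ≥ 2`), with generators `t₁ = 0`, `t₂ = 1`, `s_i = i + 1` (`1 ≤ i ≤ n - 2`) and
`u = n`: the diagram of `D_{n+1}` where the edges at the last vertex `u` are labelled `4`.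
So `B̃_2 = C̃_2`. -/
def matBt (n : ℕ) : CoxeterMatrix (Fin (n + 1)) where
  M := Matrix.of fun i j =>
    if i = j then 1
    else if ForkEdge i j ∨ ForkEdge j i then
      if (i : ℕ) = n ∨ (j : ℕ) = n then 4 else 3
    else 2
  isSymm := by
    ext i j
    simp only [Matrix.transpose_apply, Matrix.of_apply]
    grind
  diagonal := by simp
  off_diagonal := by
    intro i j h
    simp only [Matrix.of_apply]
    grind

/-- Type `Ã_n` (`n ≥ 1`): the cycle on the `n + 1` vertices `0, …, n` (the addition of
`Fin (n + 1)` is modulo `n + 1`). For `n = 1`, this is the infinite dihedral group. -/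
def matAt (n : ℕ) : CoxeterMatrix (Fin (n + 1)) where
  M := Matrix.of fun i j =>
    if i = j then 1
    else if i + 1 = j ∨ j + 1 = i then
      if n = 1 then 0 else 3
    else 2
  isSymm := by
    ext i j
    simp only [Matrix.transpose_apply, Matrix.of_apply]
    simp only [eq_comm (a := j) (b := i), or_comm (a := j + 1 = i)]
  diagonal := by simp
  off_diagonal := by
    intro i j h
    simp only [Matrix.of_apply, h, if_false]
    split_ifs <;> simp

/-- The edges `i — j`, `i < j`, of the diagram of type `D̃_n` (`n ≥ 4`) on the vertices `0, …, n`: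
the path `1 — 2 — ⋯ — (n - 1)`, together with `0 — 2` and `(n - 2) — n`. -/
def DtEdge (n i j : ℕ) : Prop :=
  (i = 0 ∧ j = 2) ∨ (1 ≤ i ∧ i + 1 = j ∧ j < n) ∨ (i + 2 = n ∧ j = n)

instance (n : ℕ) : DecidableRel (DtEdge n) := fun i j => by unfold DtEdge; infer_instance

/-- Type `D̃_n` (`n ≥ 4`), with generators `t₁ = 0`, `t₂ = 1`, `s_i = i + 1` (`1 ≤ i ≤ n - 3`),
`u₁ = n - 1` and `u₂ = n`. -/
def matDt (n : ℕ) : CoxeterMatrix (Fin (n + 1)) where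
  M := Matrix.of fun i j =>
    if i = j then 1
    else if DtEdge n i j ∨ DtEdge n j i then 3
    else 2
  isSymm := by
    ext i j
    simp only [Matrix.transpose_apply, Matrix.of_apply]
    grind
  diagonal := by simp
  off_diagonal := by
    intro i j h
    simp only [Matrix.of_apply]
    grind

/-! ### The polynomials of the classical types -/

/-- The set of cyclically fully commutative involutions of the Coxeter group of `M`. -/
def invols {B : Type*} (M : CoxeterMatrix B) : Set M.Group := cfcInvolutions M.toCoxeterSystem

/-- The length polynomial of the Coxeter group of `M`. -/
def poly {B : Type*} (M : CoxeterMatrix B) : Polynomial ℤ := lengthPoly M.toCoxeterSystem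

/-- `A_n`, for `n ≥ 0`. -/
def polyA (n : ℕ) : Polynomial ℤ := poly (CoxeterMatrix.A n)

/-- `B_n`, for `n ≥ 2`. -/
def polyB (n : ℕ) : Polynomial ℤ := poly (CoxeterMatrix.B n)

/-- `C̃_n`, for `n ≥ 1`. -/
def polyCt (n : ℕ) : Polynomial ℤ := poly (matCt n)

/-- `D_n`, for `n ≥ 1`, where `D_1` is `1` by convention. -/
def polyD (n : ℕ) : Polynomial ℤ := if n ≤ 1 then 1 else poly (matD n)

/-- `B̃_n`, for `n ≥ 2`. -/
def polyBt (n : ℕ) : Polynomial ℤ := poly (matBt n)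

/-- `Ã_n`, for `n ≥ 0`, where `Ã_0` is `1` by convention. -/
def polyAt (n : ℕ) : Polynomial ℤ := if n = 0 then 1 else poly (matAt n)

/-- `D̃_n`, for `n ≥ 4`. -/
def polyDt (n : ℕ) : Polynomial ℤ := poly (matDt n)

/-- The variable `q`. -/
abbrev q : Polynomial ℤ := Polynomial.X

/-- The variable `q` as a constant in the ring `ℤ[q]⟦x⟧`. -/
abbrev qC : PowerSeries (Polynomial ℤ) := PowerSeries.C q

/-- The variable `x` of the ring `ℤ[q]⟦x⟧`. -/
abbrev x : PowerSeries (Polynomial ℤ) := PowerSeries.X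

end CFCI

end

noncomputable section

namespace CFCI

/-! ### Commutation equivalence of words -/

section Words

variable {B : Type*} {M : CoxeterMatrix B}

/-! A CFC involution amounts to a finite set of pairwise commuting generators, and its length is the
size of that set. So the length polynomial is the independence polynomial of the Coxeter diagram
with labels forgotten. This gives finiteness and the coincidences between types; deleting an end
vertex gives the recurrences.

If `ω` is a reduced word of a CFC involution, so is its reverse, and full commutativity makes the
two commutation equivalent. No reduced word of it has the form `s ⋯ s`, since a cyclic shift would
then contain `s s`. These two facts force all letters to commute (`pairwise_of_commEquiv_reverse`).

Conversely, in the geometric representation a product of commuting generators negates the simple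
root of each of its letters, while a word avoiding `s` preserves the coordinate at `s`. Hence every
word of the product contains all these letters (`subset_of_wordProd_eq`), and its reduced words are
their arrangements, which are stable under cyclic shift.

`poly_eq_indepPoly` passes to graphs, and `indepPoly_insert` is the deletion rule behind every
recurrence. -/

theorem CommStep.append_append {a b : List B} (h : CommStep M a b) (c d : List B) :
    CommStep M (c ++ a ++ d) (c ++ b ++ d) := by
  obtain ⟨u, v, s, t, h⟩ := h
  simpa using CommStep.swap (c ++ u) (v ++ d) s t h

theorem CommEquiv.append_append {a b : List B} (h : CommEquiv M a b) (c d : List B) :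
    CommEquiv M (c ++ a ++ d) (c ++ b ++ d) :=
  Relation.ReflTransGen.lift (fun a => c ++ a ++ d) (fun _ _ h' => CommStep.append_append h' c d) _ _ h

theorem CommEquiv.refl (a : List B) : CommEquiv M a a :=
  Relation.ReflTransGen.refl

theorem CommEquiv.cons {a b : List B} (s : B) (h : CommEquiv M a b) :
    CommEquiv M (s :: a) (s :: b) := by
  simpa using h.append_append [s] []

theorem CommEquiv.trans {a b c : List B} (h : CommEquiv M a b) (h' : CommEquiv M b c) :
    CommEquiv M a c :=
  Relation.ReflTransGen.trans h h'

theorem CommEquiv.swap {s t : B} (h : M s t = 2) (u v : List B) :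
    CommEquiv M (u ++ s :: t :: v) (u ++ t :: s :: v) :=
  Relation.ReflTransGen.single (.swap u v s t h)

theorem CommEquiv.perm {a b : List B} (h : CommEquiv M a b) : a.Perm b := by
  induction h with
  | refl => rfl
  | tail _ h ih =>
    obtain ⟨u, v, s, t, -⟩ := h
    exact ih.trans ((List.Perm.swap t s v).append_left u)

/-- Serves to strip the leading letter in an induction: after erasing a first occurrence, two
swapped letters are still swapped, or one of them is gone. -/
theorem CommEquiv.erase [DecidableEq B] {a b : List B} (h : CommEquiv M a b) (r : B) :
    CommEquiv M (a.erase r) (b.erase r) := by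
  induction h with
  | refl => exact .refl _
  | tail _ h ih =>
    refine ih.trans ?_
    obtain ⟨u, v, s, t, h⟩ := h
    by_cases hr : r ∈ u
    · rw [List.erase_append_left _ hr, List.erase_append_left _ hr]
      exact .swap h _ _
    · rw [List.erase_append_right _ hr, List.erase_append_right _ hr]
      by_cases h₁ : s = r <;> by_cases h₂ : t = r
      · subst h₁ h₂
        exact .refl _
      · subst h₁
        simpa [List.erase_cons, h₂] using CommEquiv.refl _
      · subst h₂
        simpa [List.erase_cons, h₁] using CommEquiv.refl _
      · simpa [List.erase_cons, h₁, h₂] using CommEquiv.swap h u (v.erase r)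

/-- Commutation equivalent words have the same projections onto two non-commuting letters. -/
theorem CommEquiv.filter_eq [DecidableEq B] {a b : List B} (h : CommEquiv M a b) {s t : B}
    (hst : M s t ≠ 2) :
    a.filter (fun r => r = s ∨ r = t) = b.filter (fun r => r = s ∨ r = t) := by
  induction h with
  | refl => rfl
  | tail _ h ih =>
    rw [ih]
    obtain ⟨u, v, x, y, h⟩ := h
    have hxy : x ≠ y := by
      rintro rfl
      simp at h
    have h' : M y x = 2 := by rw [M.symmetric, h]
    simp only [List.filter_append, List.filter_cons]
    grind

/-- If the last letter of a word can be made to be `s` by commutations, then `s` commutes with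
all the letters after its last occurrence. -/
theorem CommEquiv.commute_of_concat {a b c : List B} {s : B}
    (h : CommEquiv M (a ++ s :: b) (c ++ [s])) (hs : s ∉ b) : ∀ t ∈ b, M s t = 2 := by
  classical
  intro t ht
  by_contra hst
  -- Project onto `s` and `t`: the right-hand word ends in `s`, while the left-hand one ends in a
  -- letter of `b`, because `t ∈ b`.
  have h' := congrArg List.getLast? (h.filter_eq hst)
  simp only [List.filter_append, List.filter_cons] at h'
  have hne : b.filter (fun r => r = s ∨ r = t) ≠ [] := fun h₀ =>
    by simpa using List.filter_eq_nil_iff.1 h₀ t ht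
  obtain ⟨d, e, hd⟩ := List.eq_nil_or_concat (b.filter (fun r => r = s ∨ r = t)) |>.resolve_left hne
  have he : e ∈ b := List.mem_of_mem_filter (p := fun r => r = s ∨ r = t) (by rw [hd]; simp)
  rw [hd] at h'
  simp [List.getLast?_append, List.getLast?_cons] at h'
  exact hs (h' ▸ he)

theorem CommEquiv.cons_concat {s : B} {b : List B} (h : ∀ t ∈ b, M s t = 2) :
    CommEquiv M (s :: b) (b ++ [s]) := by
  induction b with
  | nil => exact .refl _
  | cons t b ih =>
    exact (CommEquiv.swap (h t (by simp)) [] b).trans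
      ((ih fun r hr => h r (by simp [hr])).cons t)

/-- A word that is commutation equivalent to its reverse, and not to a word of length at least `2`
whose first and last letters agree, consists of pairwise commuting letters. -/
theorem pairwise_of_commEquiv_reverse (ω : List B) (h : CommEquiv M ω ω.reverse)
    (h' : ∀ s u, ¬ CommEquiv M ω (s :: (u ++ [s]))) : ω.Pairwise (fun s t => M s t = 2) := by
  classical
  induction ω with
  | nil => exact .nil
  | cons s u ih =>
    rw [List.reverse_cons] at h
    have hs : s ∉ u := by
      intro hs
      -- The first `s` in the reverse marks the last `s` of `u`. It commutes with what follows, so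
      -- it can be moved to the end, giving a forbidden word `s ⋯ s`.
      obtain ⟨b, a, hu, hb⟩ := List.eq_append_cons_of_mem (List.mem_reverse.2 hs)
      rw [List.reverse_eq_iff] at hu
      simp only [List.reverse_append, List.reverse_cons, List.append_assoc,
        List.singleton_append] at hu
      rw [← List.mem_reverse] at hb
      have hc := CommEquiv.commute_of_concat (M := M) (a := s :: a.reverse) (c := b ++ s :: a)
        (by simpa [hu] using h) hb
      refine h' s (a.reverse ++ b.reverse) ?_
      simpa [hu] using (CommEquiv.cons_concat hc).append_append (s :: a.reverse) []
    have hsu : ∀ t ∈ u, M s t = 2 := CommEquiv.commute_of_concat (a := []) h hs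
    refine List.pairwise_cons.2 ⟨hsu, ih ?_ fun t v hv => ?_⟩
    · have := h.erase s
      rwa [List.erase_cons_head, List.erase_append_right _ (by simpa using hs),
        List.erase_cons_head, List.append_nil] at this
    · have ht : t ∈ u := hv.perm.mem_iff.2 (by simp)
      exact h' t (s :: v) ((hv.cons s).trans (CommEquiv.swap (hsu t ht) [] _))

theorem pairwise_perm {a b : List B} (h : a.Perm b) (ha : a.Pairwise (fun s t => M s t = 2)) :
    b.Pairwise (fun s t => M s t = 2) :=
  h.pairwise ha fun {s t} hst => by rwa [M.symmetric]

theorem nodup_of_pairwise {a : List B} (ha : a.Pairwise (fun s t => M s t = 2)) : a.Nodup :=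
  ha.imp fun {s t} h => by
    rintro rfl
    simp at h

theorem CommEquiv.of_perm {a b : List B} (h : a.Perm b)
    (ha : a.Pairwise (fun s t => M s t = 2)) : CommEquiv M a b := by
  induction h with
  | nil => exact .refl _
  | cons s _ ih => exact (ih (List.pairwise_cons.1 ha).2).cons s
  | swap s t v =>
    exact CommEquiv.swap ((List.pairwise_cons.1 ha).1 s (by simp)) [] v
  | trans h₁ _ ih₁ ih₂ => exact (ih₁ ha).trans (ih₂ (pairwise_perm h₁ ha))

end Words

/-! ### The geometric representation -/

section Reflections

variable {B : Type*} (M : CoxeterMatrix B)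

open Module in
/-- A product of two reflections with suitable pairings has order dividing `m`. -/
theorem reflection_mul_reflection_pow_eq_one {V : Type*} [AddCommGroup V] [Module ℝ V]
    {x y : V} {f g : Dual ℝ V} (hf : f x = 2) (hg : g y = 2) (m : ℕ) (hm : m ≠ 1)
    (hfy : f y = -2 * Real.cos (Real.pi / m)) (hgx : g x = -2 * Real.cos (Real.pi / m)) :
    (reflection hf * reflection hg) ^ m = 1 := by
  -- `m = 0` encodes the label `∞` and imposes no relation. `m = 2` is separate because `θ = π`
  -- there, and the main case divides by `sin θ`.
  obtain rfl | hm0 := Nat.eq_zero_or_pos m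
  · simp
  obtain rfl | hm3 : m = 2 ∨ 3 ≤ m := by omega
  · have hfy : f y = 0 := by simpa using hfy
    have hgx : g x = 0 := by simpa using hgx
    ext z
    simp [pow_two, reflection_apply, hf, hg, hfy, hgx]
    module
  · have hm0' : (m : ℝ) ≠ 0 := by positivity
    set θ : ℝ := 2 * (Real.pi / m) with hθ
    have ht : 2 * Real.cos θ = f y * g x - 2 := by
      rw [hfy, hgx, hθ, Real.cos_two_mul]
      ring
    have hsin : Real.sin θ ≠ 0 := by
      refine (Real.sin_pos_of_pos_of_lt_pi (by positivity) ?_).ne'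
      have : (3 : ℝ) ≤ m := by exact_mod_cast hm3
      rw [hθ, ← mul_div_assoc, div_lt_iff₀ (by positivity)]
      nlinarith [Real.pi_pos]
    ext z
    rw [reflection_mul_reflection_pow_apply hf hg m z _ ht]
    -- By `S_j(2 cos θ) sin θ = sin((j + 1)θ)`, the Chebyshev factor vanishes: for `m = 2k` since
    -- `kθ = π`, for `m = 2k + 1` since `kθ` and `(k + 1)θ` add up to `2π`.
    obtain ⟨k, rfl | rfl⟩ := Nat.even_or_odd' m
    · have hS : (Polynomial.Chebyshev.S ℝ (k - 1)).eval (2 * Real.cos θ) = 0 := by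
        refine (mul_eq_zero.1 ((Polynomial.Chebyshev.S_two_mul_real_cos _ _).trans ?_)).resolve_right hsin
        rw [← Real.sin_pi]
        congr 1
        push_cast at hm0' ⊢
        rw [hθ]
        push_cast
        field_simp
        rw [sub_add_cancel, div_self (right_ne_zero_of_mul hm0')]
      have h₁ : (((2 * k : ℕ) : ℤ) - 2) / 2 = k - 1 := by omega
      have h₂ : (((2 * k : ℕ) : ℤ) - 1) / 2 = k - 1 := by omega
      rw [h₁, h₂, hS]
      simp
    · have hS : (Polynomial.Chebyshev.S ℝ k).eval (2 * Real.cos θ) +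
          (Polynomial.Chebyshev.S ℝ (k - 1)).eval (2 * Real.cos θ) = 0 := by
        refine (mul_eq_zero.1 ((add_mul _ _ _).trans ?_)).resolve_right hsin
        rw [Polynomial.Chebyshev.S_two_mul_real_cos, Polynomial.Chebyshev.S_two_mul_real_cos]
        have : ((k : ℤ) + 1 : ℝ) * θ = 2 * Real.pi - (((k - 1 : ℤ) : ℝ) + 1) * θ := by
          push_cast at hm0' ⊢
          rw [hθ]
          push_cast
          field_simp
          ring
        rw [this, Real.sin_two_pi_sub]
        ring
      have h₁ : (((2 * k + 1 : ℕ) : ℤ) - 1) / 2 = k := by omega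
      have h₂ : (((2 * k + 1 : ℕ) : ℤ) - 2) / 2 = k - 1 := by omega
      have h₃ : (((2 * k + 1 : ℕ) : ℤ) - 3) / 2 = k - 1 := by omega
      have h₄ : (((2 * k + 1 : ℕ) : ℤ)) / 2 = k := by omega
      rw [h₁, h₂, h₃, h₄, hS]
      simp

/-- The linear form that pairs the simple root `s` with the others. -/
def simpleCoroot (s : B) : Module.Dual ℝ (B →₀ ℝ) :=
  Finsupp.linearCombination ℝ fun t => -2 * Real.cos (Real.pi / M s t)

theorem simpleCoroot_single (s t : B) :
    simpleCoroot M s (Finsupp.single t 1) = -2 * Real.cos (Real.pi / M s t) := by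
  simp [simpleCoroot]

theorem simpleCoroot_single_self (s : B) :
    simpleCoroot M s (Finsupp.single s 1) = 2 := by
  simp [simpleCoroot]

theorem simpleCoroot_single_of_eq_two {s t : B} (h : M s t = 2) :
    simpleCoroot M s (Finsupp.single t 1) = 0 := by
  simp [simpleCoroot, h]

/-- The reflection in the simple root `s`. -/
def simpleReflection (s : B) : (B →₀ ℝ) ≃ₗ[ℝ] (B →₀ ℝ) :=
  Module.reflection (simpleCoroot_single_self M s)

theorem isLiftable_simpleReflection : M.IsLiftable (simpleReflection M) := by
  intro s t
  obtain rfl | hst := eq_or_ne s t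
  · rw [M.diagonal, pow_one]
    exact LinearEquiv.ext (Module.involutive_reflection (simpleCoroot_single_self M s))
  · exact reflection_mul_reflection_pow_eq_one (simpleCoroot_single_self M s)
      (simpleCoroot_single_self M t) _ (M.off_diagonal s t hst) (simpleCoroot_single M s t)
      (by rw [simpleCoroot_single, M.symmetric])

end Reflections

section CoxeterSystem

variable {B W : Type*} [Group W] {M : CoxeterMatrix B} (cs : CoxeterSystem M W)

/-- The geometric representation. -/
def geomRep : W →* ((B →₀ ℝ) ≃ₗ[ℝ] (B →₀ ℝ)) :=
  cs.lift ⟨simpleReflection M, isLiftable_simpleReflection M⟩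

theorem geomRep_simple (s : B) (v : B →₀ ℝ) :
    geomRep cs (cs.simple s) v = v - simpleCoroot M s v • Finsupp.single s 1 := by
  rw [geomRep, cs.lift_apply_simple (isLiftable_simpleReflection M)]
  rfl

theorem geomRep_cons (s : B) (ω : List B) (v : B →₀ ℝ) :
    geomRep cs (cs.wordProd (s :: ω)) v =
      geomRep cs (cs.simple s) (geomRep cs (cs.wordProd ω) v) := by
  rw [cs.wordProd_cons, map_mul]
  rfl

/-- A word without the letter `s` does not change the coordinate of `s`. -/
theorem geomRep_apply_of_notMem {s : B} (ω : List B) (hs : s ∉ ω) (v : B →₀ ℝ) :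
    geomRep cs (cs.wordProd ω) v s = v s := by
  induction ω with
  | nil => simp
  | cons t ω ih =>
    rw [List.mem_cons, not_or] at hs
    rw [geomRep_cons, geomRep_simple, Finsupp.sub_apply, ih hs.2]
    simp [hs.1]

theorem geomRep_single_of_commute {s : B} (ω : List B) (hs : ∀ t ∈ ω, M t s = 2) :
    geomRep cs (cs.wordProd ω) (Finsupp.single s 1) = Finsupp.single s 1 := by
  induction ω with
  | nil => simp
  | cons t ω ih =>
    rw [geomRep_cons, ih fun r hr => hs r (by simp [hr]), geomRep_simple,
      simpleCoroot_single_of_eq_two M (hs t (by simp)), zero_smul, sub_zero]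

/-- Since `M s s = 1`, the letter `s` occurs only once: it negates its root, and the other letters
fix it. -/
theorem geomRep_single_of_mem {s : B} (ω : List B) (h : ω.Pairwise (fun s t => M s t = 2))
    (hs : s ∈ ω) :
    geomRep cs (cs.wordProd ω) (Finsupp.single s 1) = -Finsupp.single s 1 := by
  induction ω with
  | nil => simp at hs
  | cons t ω ih =>
    rw [List.pairwise_cons] at h
    rw [geomRep_cons]
    obtain rfl | hs := List.mem_cons.1 hs
    · rw [geomRep_single_of_commute cs ω fun t ht => by rw [M.symmetric, h.1 t ht],
        geomRep_simple, simpleCoroot_single_self]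
      module
    · rw [ih h.2 hs, map_neg, geomRep_simple, simpleCoroot_single_of_eq_two M (h.1 s hs),
        zero_smul, sub_zero]

/-- A product of pairwise commuting simple reflections lies in no smaller parabolic subgroup. -/
theorem subset_of_wordProd_eq {ω ω' : List B} (h : ω.Pairwise (fun s t => M s t = 2))
    (h' : cs.wordProd ω' = cs.wordProd ω) : ω ⊆ ω' := by
  intro s hs
  by_contra hs'
  have h₁ := geomRep_apply_of_notMem cs ω' hs' (Finsupp.single s 1)
  rw [h', geomRep_single_of_mem cs ω h hs] at h₁
  norm_num at h₁

/-- The letters of `ω` are distinct and all occur in any reduced word of the same element, which is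
therefore at least as long. -/
theorem isReduced_of_pairwise {ω : List B} (h : ω.Pairwise (fun s t => M s t = 2)) :
    cs.IsReduced ω := by
  obtain ⟨ω', h', hω⟩ := cs.exists_isReduced (cs.wordProd ω)
  refine le_antisymm (cs.length_wordProd_le ω) ?_
  rw [hω, h'.eq]
  exact ((nodup_of_pairwise h).subperm (subset_of_wordProd_eq cs h hω.symm)).length_le

theorem perm_of_wordProd_eq {ω ω' : List B} (h : ω.Pairwise (fun s t => M s t = 2))
    (hω' : cs.IsReduced ω') (h' : cs.wordProd ω' = cs.wordProd ω) : ω.Perm ω' := by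
  refine ((nodup_of_pairwise h).subperm (subset_of_wordProd_eq cs h h')).perm_of_length_le ?_
  rw [← hω'.eq, h']
  exact cs.length_wordProd_le ω

/-! ### Cyclically fully commutative involutions -/

theorem CommEquiv.wordProd_eq {a b : List B} (h : CommEquiv M a b) :
    cs.wordProd a = cs.wordProd b := by
  induction h with
  | refl => rfl
  | tail _ h ih =>
    rw [ih]
    obtain ⟨u, v, s, t, h⟩ := h
    have hst : cs.simple s * cs.simple t = cs.simple t * cs.simple s := by
      have := cs.simple_mul_simple_pow s t
      rw [h, pow_two, mul_eq_one_iff_eq_inv] at this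
      simpa using this
    simp only [cs.wordProd_append, cs.wordProd_cons, ← mul_assoc]
    rw [mul_assoc _ (cs.simple s), hst, mul_assoc _ (cs.simple t)]

theorem pairwise_of_mem_cfcInvolutions {ω : List B} (hω : cs.IsReduced ω)
    (h : cs.wordProd ω ∈ cfcInvolutions cs) : ω.Pairwise (fun s t => M s t = 2) := by
  obtain ⟨hc, hi⟩ := h
  refine pairwise_of_commEquiv_reverse ω ?_ fun s u hu => ?_
  · have hfc := (hc ω hω rfl 0).2
    rw [List.rotate_zero] at hfc
    refine hfc ω _ hω rfl hω.reverse ?_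
    rw [cs.wordProd_reverse, inv_eq_iff_mul_eq_one, hi]
  · have hr : cs.IsReduced (s :: (u ++ [s])) := by
      rw [CoxeterSystem.IsReduced, ← hu.wordProd_eq cs, hω.eq, hu.perm.length_eq]
    -- The rotation is `u s s`; its suffix `s s` would be reduced.
    have hr' := ((hc _ hr (hu.wordProd_eq cs).symm 1).1).drop u.length
    simp [CoxeterSystem.IsReduced, cs.wordProd_cons] at hr'

/-- Reduced words of the product are permutations of `ω`, and so are their rotations; any
permutation of commuting letters is reached by commutations, the reverse included. -/
theorem mem_cfcInvolutions_of_pairwise {ω : List B} (h : ω.Pairwise (fun s t => M s t = 2)) :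
    cs.wordProd ω ∈ cfcInvolutions cs := by
  refine ⟨fun ω' hω' h' k => ?_, ?_⟩
  · have hk : (ω'.rotate k).Pairwise (fun s t => M s t = 2) :=
      pairwise_perm ((perm_of_wordProd_eq cs h hω' h').trans (List.rotate_perm ω' k).symm) h
    refine ⟨isReduced_of_pairwise cs hk, fun a b ha ha' hb hb' => ?_⟩
    have hka := perm_of_wordProd_eq cs hk ha ha'
    exact CommEquiv.of_perm (hka.symm.trans (perm_of_wordProd_eq cs hk hb hb'))
      (pairwise_perm hka hk)
  · have := (CommEquiv.of_perm (List.reverse_perm ω).symm h).wordProd_eq cs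
    rw [cs.wordProd_reverse] at this
    exact mul_eq_one_iff_eq_inv.2 this

end CoxeterSystem

end CFCI

end

noncomputable section

namespace CFCI

open Polynomial Finset

/-! ### CFC involutions as independent sets of generators -/

section Independence

variable {B : Type*} (M : CoxeterMatrix B)

theorem pairwise_toList {I : Finset B} :
    I.toList.Pairwise (fun s t => M s t = 2) ↔ (I : Set B).Pairwise (fun s t => M s t = 2) := by
  refine ⟨fun h s hs t ht hst => ?_, fun h => ?_⟩
  · have : Std.Symm fun s t => M s t = 2 := ⟨fun s t hst => by rwa [M.symmetric]⟩
    exact h.forall (by simpa using hs) (by simpa using ht) hst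
  · exact I.nodup_toList.pairwise_of_forall_ne fun s hs t ht hst =>
      h (by simpa using hs) (by simpa using ht) hst

/-- The product of the generators in a finite set, in an arbitrary order. -/
def setProd (I : Finset B) : M.Group := M.toCoxeterSystem.wordProd I.toList

theorem invols_eq_image :
    invols M = setProd M '' {I : Finset B | (I : Set B).Pairwise (fun s t => M s t = 2)} := by
  classical
  ext w
  constructor
  · intro hw
    obtain ⟨ω, hω, rfl⟩ := M.toCoxeterSystem.exists_isReduced w
    have h := pairwise_of_mem_cfcInvolutions _ hω hw
    have hp : ω.toFinset.toList.Perm ω := List.toFinset_toList (nodup_of_pairwise h)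
    exact ⟨ω.toFinset, (pairwise_toList M).1 (pairwise_perm hp.symm h),
      ((CommEquiv.of_perm hp.symm h).wordProd_eq _).symm⟩
  · rintro ⟨I, hI, rfl⟩
    exact mem_cfcInvolutions_of_pairwise _ ((pairwise_toList M).2 hI)

theorem setProd_injOn :
    Set.InjOn (setProd M) {I : Finset B | (I : Set B).Pairwise (fun s t => M s t = 2)} := by
  intro I hI J hJ h
  have hp := perm_of_wordProd_eq _ ((pairwise_toList M).2 hI)
    (isReduced_of_pairwise M.toCoxeterSystem ((pairwise_toList M).2 hJ)) h.symm
  ext s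
  rw [← mem_toList, hp.mem_iff, mem_toList]

theorem length_setProd {I : Finset B} (hI : (I : Set B).Pairwise (fun s t => M s t = 2)) :
    M.toCoxeterSystem.length (setProd M I) = #I := by
  rw [setProd, (isReduced_of_pairwise _ ((pairwise_toList M).2 hI)).eq, length_toList]

theorem invols_finite [Finite B] : (invols M).Finite := by
  rw [invols_eq_image]
  exact (Set.toFinite _).image _

open Classical in
theorem poly_eq_sum [Fintype B] :
    poly M = 
      ∑ I ∈ univ.filter (fun I : Finset B => (I : Set B).Pairwise (fun s t => M s t = 2)), X ^ #I := by
  have h := invols_eq_image M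
  rw [invols] at h
  rw [poly, lengthPoly, h, finsum_mem_image (setProd_injOn M), finsum_mem_congr rfl fun I hI => by
    rw [length_setProd M hI], ← finsum_mem_coe_finset]
  simp

end Independence

/-! ### Independence polynomials of graphs on the natural numbers -/

section Graphs

open Classical in
/-- The independence polynomial of the graph with edges `R` on the vertex set `S`. -/
def indepPoly (R : ℕ → ℕ → Prop) (S : Finset ℕ) : ℤ[X] :=
  ∑ I ∈ S.powerset.filter (fun I : Finset ℕ => (I : Set ℕ).Pairwise fun s t => ¬ R s t), X ^ #I

open Classical in
-- Only the distinction between `2` and the other labels matters. Vertices become natural numbers so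
-- that diagrams of different ranks live in one type.
theorem poly_eq_indepPoly {n : ℕ} (M : CoxeterMatrix (Fin n)) (R : ℕ → ℕ → Prop)
    (h : ∀ i j : Fin n, i ≠ j → (M i j = 2 ↔ ¬ R i j)) : poly M = indepPoly R (range n) := by
  rw [poly_eq_sum, indepPoly]
  refine sum_bij (fun I _ => I.map Fin.valEmbedding) ?_ ?_ ?_ ?_
  · intro I hI
    simp only [mem_filter, mem_univ, true_and, mem_powerset, coe_map] at hI ⊢
    refine ⟨fun i hi => ?_, ?_⟩
    · obtain ⟨j, -, rfl⟩ := mem_map.1 hi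
      simp
    · rintro _ ⟨i, hi, rfl⟩ _ ⟨j, hj, rfl⟩ hij
      have hij : i ≠ j := fun h => hij (by rw [h])
      exact (h i j hij).1 (hI hi hj hij)
  · intro I _ J _ hIJ
    exact map_injective _ hIJ
  · intro J hJ
    simp only [mem_filter, mem_powerset] at hJ
    refine ⟨J.attachFin fun i hi => mem_range.1 (hJ.1 hi), ?_, ?_⟩
    · simp only [mem_filter, mem_univ, true_and]
      intro i hi j hj hij
      refine (h i j hij).2 (hJ.2 ?_ ?_ fun h => hij (Fin.ext h))
      · simpa using hi
      · simpa using hj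
    · ext i
      simp only [mem_map, mem_attachFin, Fin.valEmbedding_apply]
      exact ⟨fun ⟨j, hj, hij⟩ => hij ▸ hj, fun hi => ⟨⟨i, mem_range.1 (hJ.1 hi)⟩, hi, rfl⟩⟩
  · intro I _
    rw [card_map]

theorem indepPoly_empty (R : ℕ → ℕ → Prop) : indepPoly R ∅ = 1 := by
  simp [indepPoly, filter_singleton]

theorem indepPoly_congr {R R' : ℕ → ℕ → Prop} {S : Finset ℕ}
    (h : ∀ s ∈ S, ∀ t ∈ S, s ≠ t → (R s t ↔ R' s t)) : indepPoly R S = indepPoly R' S := by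
  classical
  unfold indepPoly
  congr 1
  refine filter_congr fun I hI => ?_
  rw [mem_powerset] at hI
  exact ⟨fun h' s hs t ht hst => mt (h s (hI hs) t (hI ht) hst).2 (h' hs ht hst),
    fun h' s hs t ht hst => mt (h s (hI hs) t (hI ht) hst).1 (h' hs ht hst)⟩

/-- Deletion of a vertex `v`, where `S'` is the set of the vertices not adjacent to `v`. -/
theorem indepPoly_insert {R : ℕ → ℕ → Prop} (hR : ∀ i j, R i j → R j i) {S S' T : Finset ℕ} (v : ℕ)
    (hv : v ∉ S) (hT : T = insert v S) (hS : ∀ i, i ∈ S' ↔ i ∈ S ∧ ¬ R i v) :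
    indepPoly R T = indepPoly R S + X * indepPoly R S' := by
  classical
  subst hT
  simp only [indepPoly, sum_filter]
  rw [sum_powerset_insert hv, mul_sum]
  congr 1
  -- Sets containing `v` and a neighbour of `v` contribute zero.
  rw [← sum_subset (s₁ := S'.powerset) (s₂ := S.powerset)]
  · refine sum_congr rfl fun I hI => ?_
    rw [mem_powerset] at hI
    have hvI : v ∉ I := fun h => hv ((hS v).1 (hI h)).1
    have : ((insert v I : Finset ℕ) : Set ℕ).Pairwise (fun s t => ¬ R s t) ↔
        (I : Set ℕ).Pairwise (fun s t => ¬ R s t) := by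
      rw [coe_insert, Set.pairwise_insert_of_notMem (by simpa using hvI)]
      refine and_iff_left fun i hi => ?_
      have := ((hS i).1 (hI hi)).2
      exact ⟨mt (hR _ _) this, this⟩
    rw [card_insert_of_notMem hvI, if_congr this rfl rfl]
    split_ifs
    · ring
    · simp
  · intro I hI
    rw [mem_powerset] at hI ⊢
    exact fun i hi => ((hS i).1 (hI hi)).1
  · intro I hI hI'
    rw [mem_powerset] at hI hI'
    refine if_neg fun h => hI' fun i hi => (hS i).2 ⟨hI hi, ?_⟩
    refine h (by simp [mem_coe.1 hi]) (by simp) fun hiv => hv (hiv ▸ hI hi)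

/-! ### Paths: types A, B and C̃ -/

/-- The path on the natural numbers. -/
def PathEdge (i j : ℕ) : Prop := i + 1 = j ∨ j + 1 = i

theorem PathEdge.symm (i j : ℕ) : PathEdge i j → PathEdge j i := Or.symm

theorem indepPoly_path (a n : ℕ) : indepPoly PathEdge (Ico a (a + (n + 2))) =
    indepPoly PathEdge (Ico a (a + (n + 1))) + X * indepPoly PathEdge (Ico a (a + n)) := by
  refine indepPoly_insert PathEdge.symm (a + (n + 1)) (by simp) ?_ ?_
  · ext i
    simp
    omega
  · simp only [PathEdge, mem_Ico]
    omega

theorem indepPoly_path_zero (a : ℕ) : indepPoly PathEdge (Ico a (a + 0)) = 1 := by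
  simp [indepPoly_empty]

theorem indepPoly_path_one (a : ℕ) : indepPoly PathEdge (Ico a (a + 1)) = 1 + X := by
  rw [indepPoly_insert (S := ∅) (S' := ∅) PathEdge.symm a (by simp) (by simp) (by simp),
    indepPoly_empty, mul_one]

theorem polyA_eq (n : ℕ) : polyA n = indepPoly PathEdge (range n) := by
  refine poly_eq_indepPoly _ _ fun i j hij => ?_
  simp [CoxeterMatrix.A, PathEdge, hij]
  grind

theorem polyB_eq (n : ℕ) (hn : 2 ≤ n) : polyB n = polyA n := by
  rw [polyA_eq]
  refine poly_eq_indepPoly _ _ fun i j hij => ?_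
  simp [CoxeterMatrix.B, PathEdge, hij]
  grind

theorem polyCt_eq (n : ℕ) : polyCt n = polyA (n + 1) := by
  rw [polyA_eq]
  refine poly_eq_indepPoly _ _ fun i j hij => ?_
  simp [matCt, PathEdge, hij]
  grind

theorem polyA_add_two (n : ℕ) : polyA (n + 2) = polyA (n + 1) + X * polyA n := by
  simpa only [polyA_eq, range_eq_Ico, zero_add] using indepPoly_path 0 n

theorem polyA_zero : polyA 0 = 1 := by
  simpa [polyA_eq, range_eq_Ico] using indepPoly_path_zero 0

theorem polyA_one : polyA 1 = 1 + X := by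
  simpa [polyA_eq, range_eq_Ico] using indepPoly_path_one 0

/-- Translation invariance, by the common recurrence; the cycle needs a path starting at `1`. -/
theorem indepPoly_path_eq (a n : ℕ) : indepPoly PathEdge (Ico a (a + n)) = polyA n := by
  induction n using Nat.twoStepInduction with
  | zero => rw [indepPoly_path_zero, polyA_zero]
  | one => rw [indepPoly_path_one, polyA_one]
  | more n h₁ h₂ => rw [indepPoly_path, h₁, h₂, polyA_add_two]

/-! ### Forked paths: types D and B̃ -/

/-- The symmetric closure of `ForkEdge`. -/
def ForkAdj (i j : ℕ) : Prop := ForkEdge i j ∨ ForkEdge j i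

theorem ForkAdj.symm (i j : ℕ) : ForkAdj i j → ForkAdj j i := Or.symm

theorem polyD_eq (n : ℕ) (hn : 2 ≤ n) : polyD n = indepPoly ForkAdj (range n) := by
  rw [polyD, if_neg (by omega)]
  refine poly_eq_indepPoly _ _ fun i j hij => ?_
  simp [matD, ForkAdj, hij]

theorem polyBt_eq (n : ℕ) (hn : 1 ≤ n) : polyBt n = polyD (n + 1) := by
  rw [polyD_eq _ (by omega)]
  refine poly_eq_indepPoly _ _ fun i j hij => ?_
  simp [matBt, ForkAdj, hij]
  grind

theorem polyD_one : polyD 1 = 1 := by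
  simp [polyD]

theorem polyD_two : polyD 2 = 1 + 2 * X + X ^ 2 := by
  rw [polyD_eq 2 le_rfl, indepPoly_insert (S := {0}) (S' := {0}) ForkAdj.symm 1 (by simp)
      (by decide) (by simp [ForkAdj, ForkEdge]),
    indepPoly_insert (S := ∅) (S' := ∅) ForkAdj.symm 0 (by simp) (by simp) (by simp),
    indepPoly_empty]
  ring

theorem polyD_add_two (n : ℕ) (hn : 1 ≤ n) : polyD (n + 2) = polyD (n + 1) + X * polyD n := by
  obtain rfl | hn := eq_or_lt_of_le hn
  -- Vertex `2` is adjacent to both `0` and `1`, so the convention `D_1 = 1` plays the part of the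
  -- empty graph.
  · rw [polyD_eq _ (by simp), polyD_eq _ (by simp), polyD_one, ← indepPoly_empty ForkAdj]
    refine indepPoly_insert ForkAdj.symm 2 (by simp) (by decide) fun i => ?_
    simp [ForkAdj, ForkEdge]
    omega
  · rw [polyD_eq _ (by omega), polyD_eq _ (by omega), polyD_eq _ (by omega)]
    refine indepPoly_insert ForkAdj.symm (n + 1) (by simp) range_add_one fun i => ?_
    simp [ForkAdj, ForkEdge]
    omega

theorem polyD_eq_polyA (n : ℕ) :
    polyD (n + 4) = X * polyA n + (1 + 2 * X + X ^ 2) * polyA (n + 1) := by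
  induction n using Nat.twoStepInduction with
  | zero =>
    simp only [zero_add, Nat.reduceAdd, polyD_add_two 2 (by simp), polyD_add_two 1 le_rfl, polyD_one, polyD_two,
      polyA_zero, polyA_one]
    ring
  | one =>
    simp only [zero_add, Nat.reduceAdd, polyD_add_two 3 (by simp), polyD_add_two 2 (by simp), polyD_add_two 1 le_rfl,
      polyD_one, polyD_two, polyA_add_two 0, polyA_zero, polyA_one]
    ring
  | more n h₁ h₂ =>
    rw [polyD_add_two (n + 4) (by omega), h₁, h₂, polyA_add_two (n + 1), polyA_add_two n]
    ring

/-! ### Cycles: type Ã -/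

/-- The cycle on the numbers `0, …, n`. -/
def CycleEdge (n i j : ℕ) : Prop := PathEdge i j ∨ (i = 0 ∧ j = n) ∨ (i = n ∧ j = 0)

theorem CycleEdge.symm (n i j : ℕ) (h : CycleEdge n i j) : CycleEdge n j i := by
  simp only [CycleEdge, PathEdge] at h ⊢
  omega

theorem polyAt_eq (n : ℕ) (hn : 1 ≤ n) :
    polyAt n = indepPoly (CycleEdge n) (range (n + 1)) := by
  rw [polyAt, if_neg (by omega)]
  refine poly_eq_indepPoly _ _ fun i j hij => ?_
  have h (i j : Fin (n + 1)) : i + 1 = j ↔ (i : ℕ) + 1 = j ∨ (i : ℕ) = n ∧ (j : ℕ) = 0 := by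
    rw [Fin.ext_iff, Fin.val_add_one]
    split_ifs with hi
    · subst hi
      rw [Fin.val_last]
      omega
    · have : (i : ℕ) ≠ n := fun h => hi (Fin.ext h)
      omega
  simp only [matAt, CycleEdge, PathEdge, Matrix.of_apply, h]
  grind

theorem polyAt_zero : polyAt 0 = 1 := by
  simp [polyAt]

theorem polyAt_one : polyAt 1 = 1 + 2 * X := by
  rw [polyAt_eq 1 le_rfl, indepPoly_insert (S := {0}) (S' := ∅) (CycleEdge.symm _) 1 (by simp)
      (by decide) (by simp [CycleEdge, PathEdge]),
    indepPoly_insert (S := ∅) (S' := ∅) (CycleEdge.symm _) 0 (by simp) (by simp) (by simp),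
    indepPoly_empty]
  ring

/-- Deleting the vertex `n + 2` leaves a path on `n + 2` vertices; deleting its neighbours `0` and
`n + 1` as well leaves the path `1, …, n`. -/
theorem polyAt_eq_polyA (n : ℕ) : polyAt (n + 2) = polyA (n + 2) + X * polyA n := by
  have h₁ : indepPoly (CycleEdge (n + 2)) (Ico 0 (0 + (n + 2))) = polyA (n + 2) := by
    rw [← indepPoly_path_eq 0 (n + 2)]
    refine indepPoly_congr fun s hs t ht _ => ?_
    simp only [CycleEdge, PathEdge, mem_Ico] at hs ht ⊢
    omega
  have h₂ : indepPoly (CycleEdge (n + 2)) (Ico 1 (1 + n)) = polyA n := by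
    rw [← indepPoly_path_eq 1 n]
    refine indepPoly_congr fun s hs t ht _ => ?_
    simp only [CycleEdge, PathEdge, mem_Ico] at hs ht ⊢
    omega
  rw [polyAt_eq _ (by omega), ← h₁, ← h₂]
  refine indepPoly_insert (CycleEdge.symm _) (n + 2) (by simp) ?_ fun i => ?_
  · ext i
    simp only [mem_range, mem_insert, mem_Ico]
    omega
  · simp only [CycleEdge, PathEdge, mem_Ico, and_true]
    omega

theorem polyAt_add_two (n : ℕ) : polyAt (n + 2) = polyAt (n + 1) + X * polyAt n := by
  -- The terms `Ã_0` and `Ã_1` are not covered by the cycle formula.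
  obtain _ | _ | n := n
  · rw [polyAt_eq_polyA, polyAt_one, polyAt_zero, polyA_add_two, polyA_one, polyA_zero]
    ring
  · rw [polyAt_eq_polyA, polyAt_eq_polyA, polyAt_one, polyA_add_two, polyA_add_two, polyA_one,
      polyA_zero]
    ring
  · rw [polyAt_eq_polyA, polyAt_eq_polyA, polyAt_eq_polyA, polyA_add_two (n + 2),
      polyA_add_two (n + 1), polyA_add_two n]
    ring

/-! ### Two forks: type D̃ -/

/-- The symmetric closure of `DtEdge n`. -/
def DtAdj (n i j : ℕ) : Prop := DtEdge n i j ∨ DtEdge n j i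

theorem DtAdj.symm (n i j : ℕ) : DtAdj n i j → DtAdj n j i := Or.symm

theorem polyDt_eq (n : ℕ) : polyDt n = indepPoly (DtAdj n) (range (n + 1)) := by
  refine poly_eq_indepPoly _ _ fun i j hij => ?_
  simp [matDt, DtAdj, hij]

/-- Delete the leaf `n + 4`. Once its neighbour `n + 2` is also removed, the twin leaf `n + 3` is
isolated and contributes the factor `1 + X`. -/
theorem polyDt_eq_polyD (n : ℕ) :
    polyDt (n + 4) = polyD (n + 4) + X * ((1 + X) * polyD (n + 2)) := by
  rw [polyDt_eq, indepPoly_insert (S := range (n + 4)) (S' := insert (n + 3) (range (n + 2)))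
      (DtAdj.symm _) (n + 4) (by simp) range_add_one ?_,
    indepPoly_insert (S := range (n + 2)) (S' := range (n + 2))
      (DtAdj.symm _) (n + 3) (by simp) rfl ?_,
    indepPoly_congr (R' := ForkAdj) (S := range (n + 2)),
    indepPoly_congr (R' := ForkAdj) (S := range (n + 4)), ← polyD_eq _ (by omega),
    ← polyD_eq _ (by omega)]
  · ring
  all_goals
    simp [DtAdj, DtEdge, ForkAdj, ForkEdge]
    omega

theorem polyDt_add_two (n : ℕ) :
    polyDt (n + 6) = polyDt (n + 5) + X * polyDt (n + 4) := by
  rw [polyDt_eq_polyD (n + 2), polyDt_eq_polyD (n + 1), polyDt_eq_polyD n,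
    polyD_add_two (n + 4) (by omega), polyD_add_two (n + 2) (by omega)]
  ring

theorem polyDt_four : polyDt 4 = 1 + 5 * X + 6 * X ^ 2 + 4 * X ^ 3 + X ^ 4 := by
  rw [polyDt_eq_polyD 0, polyD_add_two 2 (by simp), polyD_add_two 1 le_rfl, polyD_one]
  simp only [zero_add, Nat.reduceAdd, polyD_two]
  ring

theorem polyDt_five : polyDt 5 = 1 + 6 * X + 10 * X ^ 2 + 6 * X ^ 3 + X ^ 4 := by
  rw [polyDt_eq_polyD 1, polyD_add_two 3 (by simp), polyD_add_two 2 (by simp),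
    polyD_add_two 1 le_rfl, polyD_one, polyD_two]
  ring

/-! ### Generating functions -/

/-- The generating function of a sequence that satisfies the recurrence relation of the
independence polynomials of paths. -/
theorem mk_mul_eq (f : ℕ → ℤ[X]) (h : ∀ n, f (n + 2) = f (n + 1) + X * f n) :
    PowerSeries.mk f * (1 - x - qC * x ^ 2) =
      PowerSeries.C (f 0) + PowerSeries.C (f 1 - f 0) * x := by
  rw [mul_sub, mul_sub, mul_one, mul_left_comm, ← mul_assoc qC]
  ext1 n
  -- Coefficients `0` and `1` carry the initial values; the recurrence kills all the others.
  obtain _ | _ | n := n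
  · simp [pow_two, ← mul_assoc]
  · simp [pow_two, ← mul_assoc, PowerSeries.coeff_succ_mul_X]
  · simp [pow_two, ← mul_assoc, PowerSeries.coeff_succ_mul_X, h]

/-- Shifting the index of a generating function. -/
theorem mk_shift (f : ℕ → ℤ[X]) (k : ℕ) :
    PowerSeries.mk (fun n => if k ≤ n then f (n - k) else 0) = x ^ k * PowerSeries.mk f := by
  ext1 n
  simp [PowerSeries.coeff_X_pow_mul']

end Graphs

end CFCI

end

/-- An identity `F(x) = N / (1 - x - q x²)` of formal power series in `ℤ[q]⟦x⟧` is written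
`F(x) * (1 - x - q x²) = N` (the denominator is invertible, its constant term being `1`). -/
theorem theorem4p3 :
    -- the sets of CFC involutions are finite, so that their length polynomials make sense
    ((∀ n, (CFCI.invols (CoxeterMatrix.A n)).Finite) ∧
      (∀ n, 2 ≤ n → (CFCI.invols (CoxeterMatrix.B n)).Finite) ∧
      (∀ n, 1 ≤ n → (CFCI.invols (CFCI.matCt n)).Finite) ∧
      (∀ n, 2 ≤ n → (CFCI.invols (CFCI.matD n)).Finite) ∧
      (∀ n, 2 ≤ n → (CFCI.invols (CFCI.matBt n)).Finite) ∧
      (∀ n, 1 ≤ n → (CFCI.invols (CFCI.matAt n)).Finite) ∧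
      (∀ n, 4 ≤ n → (CFCI.invols (CFCI.matDt n)).Finite)) ∧
    -- types A, B and C̃
    ((∀ n, 2 ≤ n →
        CFCI.polyA n = CFCI.polyB n ∧
        CFCI.polyB n = CFCI.polyCt (n - 1) ∧
        CFCI.polyCt (n - 1) = CFCI.polyA (n - 1) + CFCI.q * CFCI.polyA (n - 2)) ∧
      CFCI.polyA 0 = 1 ∧
      CFCI.polyA 1 = 1 + CFCI.q ∧
      PowerSeries.mk (fun n => if 1 ≤ n then CFCI.polyA (n - 1) else 0) *
          (1 - CFCI.x - CFCI.qC * CFCI.x ^ 2) =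
        CFCI.x * (1 + CFCI.qC * CFCI.x)) ∧
    -- types D and B̃
    ((∀ n, 3 ≤ n →
        CFCI.polyD n = CFCI.polyBt (n - 1) ∧
        CFCI.polyBt (n - 1) = CFCI.polyD (n - 1) + CFCI.q * CFCI.polyD (n - 2)) ∧
      (∀ n, 3 ≤ n →
        CFCI.polyD (n + 1) = CFCI.q * CFCI.polyA (n - 3) +
          (1 + 2 * CFCI.q + CFCI.q ^ 2) * CFCI.polyA (n - 2)) ∧
      CFCI.polyD 1 = 1 ∧
      CFCI.polyD 2 = 1 + 2 * CFCI.q + CFCI.q ^ 2 ∧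
      CFCI.polyD 3 = 1 + 3 * CFCI.q + CFCI.q ^ 2 ∧
      PowerSeries.mk (fun n => CFCI.polyD (n + 1)) * (1 - CFCI.x - CFCI.qC * CFCI.x ^ 2) =
        1 + (2 * CFCI.qC + CFCI.qC ^ 2) * CFCI.x) ∧
    -- type Ã
    ((∀ n, 2 ≤ n →
        CFCI.polyAt n = CFCI.polyAt (n - 1) + CFCI.q * CFCI.polyAt (n - 2)) ∧
      CFCI.polyAt 0 = 1 ∧
      CFCI.polyAt 1 = 1 + 2 * CFCI.q ∧
      PowerSeries.mk (fun n => if 1 ≤ n then CFCI.polyAt (n - 1) else 0) *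
          (1 - CFCI.x - CFCI.qC * CFCI.x ^ 2) =
        CFCI.x * (1 + 2 * CFCI.qC * CFCI.x)) ∧
    -- type D̃
    ((∀ n, 4 ≤ n →
        CFCI.polyDt (n + 2) = CFCI.polyDt (n + 1) + CFCI.q * CFCI.polyDt n) ∧
      CFCI.polyDt 4 =
        1 + 5 * CFCI.q + 6 * CFCI.q ^ 2 + 4 * CFCI.q ^ 3 + CFCI.q ^ 4 ∧
      CFCI.polyDt 5 =
        1 + 6 * CFCI.q + 10 * CFCI.q ^ 2 + 6 * CFCI.q ^ 3 + CFCI.q ^ 4 ∧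
      PowerSeries.mk (fun n => if 2 ≤ n then CFCI.polyDt (n + 2) else 0) *
          (1 - CFCI.x - CFCI.qC * CFCI.x ^ 2) =
        CFCI.x ^ 2 *
          (1 + 5 * CFCI.qC + 6 * CFCI.qC ^ 2 + 4 * CFCI.qC ^ 3 + CFCI.qC ^ 4 +
            CFCI.x * (CFCI.qC + 4 * CFCI.qC ^ 2 + 2 * CFCI.qC ^ 3))) := by
  refine ⟨⟨fun n => CFCI.invols_finite _, fun n _ => CFCI.invols_finite _,
    fun n _ => CFCI.invols_finite _, fun n _ => CFCI.invols_finite _,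
    fun n _ => CFCI.invols_finite _, fun n _ => CFCI.invols_finite _,
    fun n _ => CFCI.invols_finite _⟩, ⟨fun n hn => ?_, CFCI.polyA_zero, CFCI.polyA_one, ?_⟩,
    ⟨fun n hn => ?_, fun n hn => ?_, CFCI.polyD_one, CFCI.polyD_two, ?_, ?_⟩,
    ⟨fun n hn => ?_, CFCI.polyAt_zero, CFCI.polyAt_one, ?_⟩,
    ⟨fun n hn => ?_, CFCI.polyDt_four, CFCI.polyDt_five, ?_⟩⟩
  · obtain ⟨n, rfl⟩ := Nat.exists_eq_add_of_le' hn
    refine ⟨(CFCI.polyB_eq _ hn).symm, ?_, ?_⟩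
    · rw [CFCI.polyB_eq _ hn, CFCI.polyCt_eq]
      rfl
    · rw [CFCI.polyCt_eq]
      exact CFCI.polyA_add_two n
  · rw [CFCI.mk_shift CFCI.polyA 1, mul_assoc, CFCI.mk_mul_eq _ CFCI.polyA_add_two,
      CFCI.polyA_zero, CFCI.polyA_one]
    simp
  · obtain ⟨n, rfl⟩ := Nat.exists_eq_add_of_le' hn
    have h := CFCI.polyBt_eq (n + 3 - 1) (by omega)
    exact ⟨h.symm, h.trans (CFCI.polyD_add_two (n + 1) (by omega))⟩
  · obtain ⟨n, rfl⟩ := Nat.exists_eq_add_of_le' hn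
    exact CFCI.polyD_eq_polyA n
  · rw [CFCI.polyD_add_two 1 le_rfl, CFCI.polyD_one, CFCI.polyD_two]
    ring
  · rw [CFCI.mk_mul_eq _ fun n => CFCI.polyD_add_two (n + 1) (by omega), CFCI.polyD_one]
    simp only [Nat.reduceAdd, CFCI.polyD_two, map_add, map_sub, map_mul, map_pow, map_one, map_ofNat]
    ring
  · obtain ⟨n, rfl⟩ := Nat.exists_eq_add_of_le' hn
    exact CFCI.polyAt_add_two n
  · rw [CFCI.mk_shift CFCI.polyAt 1, mul_assoc, CFCI.mk_mul_eq _ CFCI.polyAt_add_two,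
      CFCI.polyAt_zero, CFCI.polyAt_one]
    simp only [map_add, map_sub, map_mul, map_one, map_ofNat]
    ring
  · obtain ⟨n, rfl⟩ := Nat.exists_eq_add_of_le' hn
    exact CFCI.polyDt_add_two n
  -- The series starts with `x² D̃_4`, so the sequence to shift by `2` starts at index `4`.
  · have h := CFCI.mk_shift (fun n => CFCI.polyDt (n + 4)) 2
    have h' : (fun n => if 2 ≤ n then CFCI.polyDt (n + 2) else 0) =
        fun n => if 2 ≤ n then CFCI.polyDt (n - 2 + 4) else 0 := by
      funext n
      split_ifs with hn
      · congr 1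
        omega
      · rfl
    rw [h', h, mul_assoc, CFCI.mk_mul_eq _ CFCI.polyDt_add_two]
    simp only [zero_add, Nat.reduceAdd, CFCI.polyDt_four, CFCI.polyDt_five, map_add,
      map_sub, map_mul, map_pow, map_one, map_ofNat]
    ring
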